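/- Let $K$ be a field, $R=K[x_1,\dots,x_n]$, $I\subseteq R$ a monomial ideal and $G(I)$ its (finite) set of minimal monomial generators. For a finite set $A$ of monomials, $\operatorname{lcm}(A)$ is the least common multiple of its elements, with $\operatorname{lcm}(\emptyset)=1$. **Definitions.** A set $C\subseteq G(I)$ is a *cover* of $u$ if $u\in C$ and $u\mid\operatorname{lcm}(C\setminus\{u\})$; it is an *$E$-minimal cover* of $u$ if moreover no proper subset of $C$ is a cover of $u$. For $D\subseteq G(I)$ put $\overline D=\{w\in G(I): w\mid\operatorname{lcm}(D)\}$. Let $<$ be a total order on $G(I)$. A non-empty set $D\subseteq G(I)$ is *broken* if there is $u\in G(I)$ with $u\mid\operatorname{lcm}(D)$ and $u<\min(D)$; a set $E\subseteq G(I)$ is *preserved* if no subset of $E$ is broken. Write $G(I)=\{m_1<\dots<m_\mu\}$. A symbol $u(i_1;\dots;i_t)$ with $1\le i_1<\dots<i_t\le\mu$ is *$L$-admissible* if $m_q\nmid\operatorname{lcm}(m_{i_h},\dots,m_{i_t})$ for all $h<t$ and all $q<i_h$. Let $L^t$ be the free $R$-module on the $L$-admissible symbols of dimension $t$ (so $L^0=R$).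 The *Lyubeznik resolution* of $R/I$ with respect to $<$ is the sequence $\cdots\to L^2\xrightarrow{\partial_2}L^1\xrightarrow{\partial_1}L^0\to R/I\to0$, where $L^0=R\to R/I$ is the quotient map and, for $t\ge1$, $$\partial_t\,u(i_1;\dots;i_t)=\sum_{j=1}^t(-1)^{j+1}\frac{\operatorname{lcm}(m_{i_1},\dots,m_{i_t})}{\operatorname{lcm}(m_{i_1},\dots,\widehat{m_{i_j}},\dots,m_{i_t})}\,u(i_1;\dots;\widehat{i_j};\dots;i_t).$$ It is a *minimal free resolution* of $R/I$ if this sequence is exact and $\partial_t(L^t)\subseteq(x_1,\dots,x_n)L^{t-1}$ for all $t\ge1$. The ideal $I$ is a *Lyubeznik ideal* if there is a total order on $G(I)$ for which the Lyubeznik resolution is a minimal free resolution of $R/I$. **Theorem.** Let $<$ be a total order on $G(I)$. The following are equivalent: 1. The Lyubeznik resolution of $R/I$ with respect to $<$ is a minimal free resolution of $R/I$. 2. For every $u\in G(I)$ and every cover $C$ of $u$, $C$ is not preserved. 3. For every $u\in G(I)$ and every cover $C$ of $u$, there are a non-empty $D\subseteq C$ and $v\in G(I)\setminus D$ such that $D\cup\{v\}$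 is a cover of $v$ and $\min(\overline D\setminus D)<\min(D)$. 4. For every $u\in G(I)$ and every $E$-minimal cover $C$ of $u$, $C$ is not preserved. 5. For every $u\in G(I)$ and every $E$-minimal cover $C$ of $u$, there are a non-empty $D\subseteq C$ and $v\in G(I)\setminus D$ such that $D\cup\{v\}$ is an $E$-minimal cover of $v$ and $\min(\overline D\setminus D)<\min(D)$. **Corollary.** The following are equivalent: $I$ is a Lyubeznik ideal; there is a total order on $G(I)$ that satisfies 2; there is one that satisfies 3; there is one that satisfies 4; there is one that satisfies 5. -/

import Mathlib

namespace LyubeznikRes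

/-! Monomials of `K[x_1, …, x_n]` are represented by their exponent vectors `Fin n →₀ ℕ`:
divisibility is `≤`, the least common multiple is `⊔`, and the monomial `1` is `0`. -/

section Combinatorics

variable {n : ℕ} {ι : Type} (m : ι → (Fin n →₀ ℕ))

/-- The multidegree `lcm(A)` of a finite set `A` of the monomials `m i`; `lcm(∅) = 1`. -/
noncomputable def multideg (A : Finset ι) : Fin n →₀ ℕ := A.sup m

/-- `C` is a cover of `u`: `u ∈ C` and `u ∣ lcm(C - {u})`. -/
def IsCover [DecidableEq ι] (C : Finset ι) (u : ι) : Prop :=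
  u ∈ C ∧ m u ≤ multideg m (C.erase u)

/-- `C` is an `E`-minimal cover of `u`: a cover of `u` no proper subset of which covers `u`. -/
def IsEMinimalCover [DecidableEq ι] (C : Finset ι) (u : ι) : Prop :=
  IsCover m C u ∧ ∀ V : Finset ι, V ⊂ C → ¬ IsCover m V u

/-- The set `{w ∣ w divides lcm(D)}`, written `D` with a bar. -/
def completion (D : Finset ι) : Set ι := {w | m w ≤ multideg m D}

variable [LinearOrder ι]

/-- `D` is broken: some `u` divides `lcm(D)` and `u < min(D)`. -/
def IsBroken (D : Finset ι) : Prop :=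
  ∃ b, IsLeast (D : Set ι) b ∧ ∃ u, m u ≤ multideg m D ∧ u < b

/-- `E` is preserved: no subset of `E` is broken. -/
def IsPreserved (E : Finset ι) : Prop :=
  ∀ D : Finset ι, D ⊆ E → ¬ IsBroken m D

/-- `min(completion of D, minus D) < min(D)`, both minima being attained. -/
def MinCondition (D : Finset ι) : Prop :=
  ∃ a b, IsLeast (completion m D \ (D : Set ι)) a ∧ IsLeast (D : Set ι) b ∧ a < b

/-- The symbol `u(i_1; …; i_t)`, `i_1 < ⋯ < i_t`, is given by the set `F = {i_1, …, i_t}`. It is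
`L`-admissible if for all `h < t` and `q < i_h`, `m q` does not divide
`lcm(m i_h, …, m i_t)`. Here `i` is `i_h`, and `h < t` says that `i` is not the largest index. -/
def IsLAdmissible (F : Finset ι) : Prop :=
  ∀ i ∈ F, (∃ j ∈ F, i < j) → ∀ q, q < i → ¬ m q ≤ multideg m (F.filter (fun k => i ≤ k))

theorem IsLAdmissible.erase {F : Finset ι} (hF : IsLAdmissible m F) (j : ι) :
    IsLAdmissible m (F.erase j) := by
  intro i hi ⟨k, hk, hik⟩ q hq hle
  refine hF i (Finset.mem_of_mem_erase hi) ⟨k, Finset.mem_of_mem_erase hk, hik⟩ q hq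
    (hle.trans (Finset.sup_mono ?_))
  exact Finset.filter_subset_filter _ (Finset.erase_subset _ _)

/-- The `L`-admissible symbols of dimension `t`. -/
abbrev Symb (t : ℕ) : Type := {F : Finset ι // IsLAdmissible m F ∧ F.card = t}

variable {m}

/-- The face of a symbol obtained by omitting the index `j`. -/
def Symb.face {t : ℕ} (F : Symb m (t + 1)) (j : {j // j ∈ F.1}) : Symb m t :=
  ⟨F.1.erase j.1, F.2.1.erase m j.1, by
    rw [Finset.card_erase_of_mem j.2, F.2.2, Nat.add_sub_cancel]⟩

end Combinatorics

noncomputable section Complex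

variable (K : Type*) [Field K] {n : ℕ} {ι : Type} [LinearOrder ι] (m : ι → (Fin n →₀ ℕ))

/-- `L^t`, the free `K[x_1, …, x_n]`-module on the `L`-admissible symbols of dimension `t`. The only
symbol of dimension `0` is the empty one, so that `L^0` is free of rank one. -/
abbrev L (t : ℕ) : Type _ := Symb m t →₀ MvPolynomial (Fin n) K

/-- The differential `L^{t+1} → L^t`. For `j = i_k` the sign is `(-1)^{k+1}`, and `k - 1` is the
number of elements of `F` below `j`; the difference of exponents is the quotient
`lcm(F) / lcm(F - {j})`, the subtraction being exact since `lcm(F - {j})` divides `lcm(F)`. -/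
def differential (t : ℕ) : L K m (t + 1) →ₗ[MvPolynomial (Fin n) K] L K m t :=
  Finsupp.linearCombination (MvPolynomial (Fin n) K) fun F : Symb m (t + 1) =>
    ∑ j ∈ F.1.attach,
      Finsupp.single (F.face j)
        (MvPolynomial.monomial (multideg m F.1 - multideg m (F.1.erase j.1))
          ((-1 : K) ^ (F.1.filter (fun i => i < j.1)).card))

/-- The augmentation `L^0 = R → R/I`, sending the empty symbol to the class of `1`. -/
def augmentation (I : Ideal (MvPolynomial (Fin n) K)) :
    L K m 0 →ₗ[MvPolynomial (Fin n) K] (MvPolynomial (Fin n) K ⧸ I) :=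
  Finsupp.linearCombination (MvPolynomial (Fin n) K) fun _ => 1

end Complex

/-- The sequence `⋯ → M 2 → M 1 → M 0 → N → 0` is a free resolution of `N` that is minimal with
respect to the ideal `𝔪`. -/
structure IsMinimalFreeResolution {R : Type*} [CommRing R] (𝔪 : Ideal R) {M : ℕ → Type*}
    [∀ t, AddCommGroup (M t)] [∀ t, Module R (M t)] {N : Type*} [AddCommGroup N] [Module R N]
    (d : ∀ t, M (t + 1) →ₗ[R] M t) (ε : M 0 →ₗ[R] N) : Prop where
  free : ∀ t, Module.Free R (M t)
  exact_succ : ∀ t, Function.Exact (d (t + 1)) (d t)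
  exact_zero : Function.Exact (d 0) ε
  surjective : Function.Surjective ε
  minimal : ∀ t, LinearMap.range (d t) ≤ 𝔪 • (⊤ : Submodule R (M t))

section Ideals

variable {K : Type*} [Field K] {n : ℕ}

/-- An ideal generated by monomials. -/
def IsMonomialIdeal (I : Ideal (MvPolynomial (Fin n) K)) : Prop :=
  ∃ S : Set (Fin n →₀ ℕ), I = Ideal.span ((fun a => MvPolynomial.monomial a (1 : K)) '' S)

/-- `G(I)`, the minimal monomial generators of a monomial ideal `I`: the monomials in `I` that are
minimal with respect to divisibility. It is a type of its own, so that it carries no order except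
the total order that one chooses. -/
def G (I : Ideal (MvPolynomial (Fin n) K)) : Type :=
  {a : Fin n →₀ ℕ // Minimal (fun b => MvPolynomial.monomial b (1 : K) ∈ I) a}

/-- The exponent vector of a minimal generator. -/
def gen (I : Ideal (MvPolynomial (Fin n) K)) : G I → (Fin n →₀ ℕ) := fun g => g.1

/-- The Lyubeznik resolution of `R/I` with respect to the given total order on `G(I)` is a minimal
free resolution; minimality is with respect to the homogeneous maximal ideal `(x_1, …, x_n)`. -/
def LyubeznikIsMinimal (I : Ideal (MvPolynomial (Fin n) K)) [LinearOrder (G I)] : Prop :=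
  IsMinimalFreeResolution
    (Ideal.span (Set.range (MvPolynomial.X : Fin n → MvPolynomial (Fin n) K)))
    (differential K (gen I)) (augmentation K (gen I) I)

/-- `I` is a Lyubeznik ideal. -/
def IsLyubeznikIdeal (I : Ideal (MvPolynomial (Fin n) K)) : Prop :=
  ∃ _ : LinearOrder (G I), LyubeznikIsMinimal I

end Ideals

end LyubeznikRes

namespace LyubeznikRes

/-! ### Combinatorics of covers, broken sets and preserved sets. -/

section Covers

variable {n : ℕ} {ι : Type} {m : ι → (Fin n →₀ ℕ)}

/-! The Lyubeznik complex is a free resolution for every total order, so only minimality is at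
stake. Multiplying each symbol `F` by `lcm(F)` embeds the complex in the simplicial chain complex
over `R` (`homogenize_differential`). In multidegree `a`, adjoining the least generator that divides
`a` is a contracting homotopy; by the choice of the least one it preserves `L`-admissibility
(`homotopy_homogenize_mem_range`).

The matrix entry of the differential from `F` to `F - {j}` is `± lcm(F) / lcm(F - {j})`. It escapes
the maximal ideal only if it is constant, that is, if `F` covers `j`. Thus minimality says that no
cover is `L`-admissible (`minimal_differential_iff`). Since no generator divides another,
`L`-admissible means preserved, and this gives 1 ⇔ 2.

The remaining equivalences rest on three facts: every cover contains an `E`-minimal one; subsets of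
preserved sets are preserved; and if `u` breaks `D`, then `D ∪ {u}` covers `u`. -/

theorem multideg_le {A : Finset ι} {a : Fin n →₀ ℕ} :
    multideg m A ≤ a ↔ ∀ i ∈ A, m i ≤ a :=
  Finset.sup_le_iff

theorem multideg_mono {A B : Finset ι} (h : A ⊆ B) : multideg m A ≤ multideg m B :=
  Finset.sup_mono h

theorem IsCover.exists_isEMinimalCover_subset [DecidableEq ι] {C : Finset ι} {u : ι}
    (hC : IsCover m C u) : ∃ C' ⊆ C, IsEMinimalCover m C' u := by
  induction C using Finset.strongInduction with
  | H C ih =>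
    by_cases h : ∃ V ⊂ C, IsCover m V u
    · obtain ⟨V, hV, hVu⟩ := h
      obtain ⟨C', hC', hmin⟩ := ih V hV hVu
      exact ⟨C', hC'.trans hV.subset, hmin⟩
    · exact ⟨C, subset_rfl, hC, fun V hV hVu => h ⟨V, hV, hVu⟩⟩

variable [LinearOrder ι]

theorem IsPreserved.mono {E F : Finset ι} (hF : IsPreserved m F) (h : E ⊆ F) :
    IsPreserved m E :=
  fun D hD => hF D (hD.trans h)

theorem MinCondition.isBroken {D : Finset ι} (h : MinCondition m D) : IsBroken m D := by
  obtain ⟨a, b, ha, hb, hab⟩ := h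
  exact ⟨b, hb, a, ha.1.1, hab⟩

theorem IsBroken.minCondition [Finite ι] {D : Finset ι} (h : IsBroken m D) :
    MinCondition m D := by
  obtain ⟨b, hb, u, hu, hub⟩ := h
  have huD : u ∉ (D : Set ι) := fun huD => (hb.2 huD).not_gt hub
  obtain ⟨a, ha, hmin⟩ := Set.exists_min_image (completion m D \ (D : Set ι)) id
    (Set.toFinite _) ⟨u, hu, huD⟩
  exact ⟨a, b, ⟨ha, hmin⟩, hb, (hmin u ⟨hu, huD⟩).trans_lt hub⟩

theorem IsBroken.exists_isCover_insert {D : Finset ι} (h : IsBroken m D) :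
    ∃ v ∉ D, IsCover m (insert v D) v := by
  obtain ⟨b, hb, u, hu, hub⟩ := h
  have huD : u ∉ D := fun huD => (hb.2 huD).not_gt hub
  refine ⟨u, huD, Finset.mem_insert_self _ _, ?_⟩
  rwa [Finset.erase_insert huD]

/-- A broken set has a broken subset which, together with a new element, is an `E`-minimal cover
of that element. -/
theorem IsBroken.exists_isEMinimalCover_insert (hm : ∀ i j, m i ≤ m j → i = j) {D : Finset ι}
    (h : IsBroken m D) :
    ∃ D' v, D' ⊆ D ∧ v ∉ D' ∧ IsEMinimalCover m (insert v D') v ∧ IsBroken m D' := by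
  obtain ⟨b, hb, u, hu, hub⟩ := h
  have huD : u ∉ D := fun huD => (hb.2 huD).not_gt hub
  have hcov : IsCover m (insert u D) u :=
    ⟨Finset.mem_insert_self _ _, by rwa [Finset.erase_insert huD]⟩
  obtain ⟨C, hCD, hC⟩ := hcov.exists_isEMinimalCover_subset
  have hsub : C.erase u ⊆ D := by
    rw [← Finset.erase_insert huD]
    exact Finset.erase_subset_erase u hCD
  refine ⟨C.erase u, u, hsub, Finset.notMem_erase _ _, ?_, ?_⟩
  · rwa [Finset.insert_erase hC.1.1]
  · have hne : (C.erase u).Nonempty := by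
      rw [Finset.nonempty_iff_ne_empty]
      intro h0
      have h1 := hC.1.2
      rw [h0] at h1
      -- If `C = {u}`, then `m u` divides `1`, hence also `m b`, which forces `u = b`.
      have h2 : m u ≤ m b := h1.trans (by simp [multideg])
      exact hub.ne (hm _ _ h2)
    refine ⟨(C.erase u).min' hne, Finset.isLeast_min' _ hne, u, hC.1.2, hub.trans_le ?_⟩
    exact hb.2 (hsub (Finset.min'_mem _ hne))

/-- A broken subset with minimum `b` lies in the tail of `F` from `b`, so it violates admissibility
unless `b` is the last index. In that case the subset is `{b}`, which cannot be broken because no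
generator divides another. Conversely, a violation makes a tail of `F` broken. -/
theorem isLAdmissible_iff_isPreserved (hm : ∀ i j, m i ≤ m j → i = j) {F : Finset ι} :
    IsLAdmissible m F ↔ IsPreserved m F := by
  constructor
  · rintro hF D hDF ⟨b, hb, u, hu, hub⟩
    have hDb : D ⊆ F.filter (fun k => b ≤ k) := fun k hk =>
      Finset.mem_filter.2 ⟨hDF hk, hb.2 hk⟩
    by_cases hlt : ∃ j ∈ F, b < j
    · exact hF b (hDF hb.1) hlt u hub (hu.trans (multideg_mono hDb))
    · push Not at hlt
      have h1 : multideg m D ≤ m b := multideg_le.2 fun k hk => by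
        rw [le_antisymm (hlt k (hDF hk)) (hb.2 hk)]
      exact hub.ne (hm _ _ (hu.trans h1))
  · intro hF i hi _ q hq hle
    exact hF _ (Finset.filter_subset _ _) ⟨i, ⟨by simpa using hi, fun k hk => by
      simpa using (Finset.mem_filter.1 (Finset.mem_coe.1 hk)).2⟩, q, hle, hq⟩

theorem tfae_forall_cover_not_isPreserved [Finite ι] (hm : ∀ i j, m i ≤ m j → i = j) :
    List.TFAE [
      ∀ u C, IsCover m C u → ¬ IsPreserved m C,
      ∀ u C, IsCover m C u →
        ∃ D v, D ⊆ C ∧ v ∉ D ∧ IsCover m (insert v D) v ∧ MinCondition m D,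
      ∀ u C, IsEMinimalCover m C u → ¬ IsPreserved m C,
      ∀ u C, IsEMinimalCover m C u →
        ∃ D v, D ⊆ C ∧ v ∉ D ∧ IsEMinimalCover m (insert v D) v ∧ MinCondition m D] := by
  have exists_isBroken {C : Finset ι} (h : ¬ IsPreserved m C) : ∃ D ⊆ C, IsBroken m D := by
    simpa [IsPreserved] using h
  tfae_have 1 → 2 := fun h u C hC => by
    obtain ⟨D, hDC, hD⟩ := exists_isBroken (h u C hC)
    obtain ⟨v, hv, hcov⟩ := hD.exists_isCover_insert
    exact ⟨D, v, hDC, hv, hcov, hD.minCondition⟩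
  tfae_have 2 → 1 := fun h u C hC hpres => by
    obtain ⟨D, v, hDC, -, -, hD⟩ := h u C hC
    exact hpres D hDC hD.isBroken
  tfae_have 1 → 3 := fun h u C hC => h u C hC.1
  tfae_have 3 → 1 := fun h u C hC hpres => by
    obtain ⟨C', hC', hmin⟩ := hC.exists_isEMinimalCover_subset
    exact h u C' hmin (hpres.mono hC')
  tfae_have 3 → 4 := fun h u C hC => by
    obtain ⟨D, hDC, hD⟩ := exists_isBroken (h u C hC)
    obtain ⟨D', v, hD', hv, hcov, hb⟩ := hD.exists_isEMinimalCover_insert hm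
    exact ⟨D', v, hD'.trans hDC, hv, hcov, hb.minCondition⟩
  tfae_have 4 → 3 := fun h u C hC hpres => by
    obtain ⟨D, v, hDC, -, -, hD⟩ := h u C hC
    exact hpres D hDC hD.isBroken
  tfae_finish

end Covers

/-! ### The simplicial chain complex on all finite subsets -/

noncomputable section Simplicial

variable (R : Type*) [CommRing R] {ι : Type} [LinearOrder ι]

/-- The incidence sign of the facet of `F` omitting `j`. -/
def incidence (F : Finset ι) (j : ι) : ℤ := (-1) ^ (F.filter (fun i => i < j)).card

/-- The augmented simplicial boundary on the free module on all finite subsets of `ι`. -/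
def boundary : (Finset ι →₀ R) →ₗ[R] (Finset ι →₀ R) :=
  Finsupp.linearCombination R fun F =>
    ∑ j ∈ F, incidence F j • Finsupp.single (F.erase j) (1 : R)

/-- The operator that adjoins the vertex `q`. -/
def cone (q : ι) : (Finset ι →₀ R) →ₗ[R] (Finset ι →₀ R) :=
  Finsupp.linearCombination R fun F =>
    if q ∈ F then 0 else Finsupp.single (insert q F) (1 : R)

variable {R}

theorem boundary_single (F : Finset ι) (r : R) :
    boundary R (Finsupp.single F r) =
      ∑ j ∈ F, incidence F j • Finsupp.single (F.erase j) r := by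
  simp only [boundary, Finsupp.linearCombination_single, Finset.smul_sum, smul_comm r,
    Finsupp.smul_single_one]

theorem cone_single (q : ι) (F : Finset ι) (r : R) :
    cone R q (Finsupp.single F r) = if q ∈ F then 0 else Finsupp.single (insert q F) r := by
  by_cases h : q ∈ F <;> simp [cone, h]

theorem incidence_eq_one {F : Finset ι} {q : ι} (h : ∀ i ∈ F, q ≤ i) : incidence F q = 1 := by
  have : F.filter (fun i => i < q) = ∅ :=
    Finset.filter_eq_empty_iff.2 fun i hi => (h i hi).not_gt
  simp [incidence, this]

theorem incidence_insert_of_lt {F : Finset ι} {q j : ι} (hq : q ∉ F) (hqj : q < j) :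
    incidence (insert q F) j = -incidence F j := by
  rw [incidence, incidence, Finset.filter_insert, if_pos hqj, Finset.card_insert_of_notMem
    (fun h => hq (Finset.mem_of_mem_filter _ h)), pow_succ]
  ring

theorem incidence_erase_of_lt {F : Finset ι} {q j : ι} (hq : q ∈ F) (hqj : q < j) :
    incidence (F.erase q) j = -incidence F j := by
  have := incidence_insert_of_lt (Finset.notMem_erase q F) hqj
  rw [Finset.insert_erase hq] at this
  rw [this, neg_neg]

theorem incidence_erase_of_gt {F : Finset ι} {q j : ι} (hqj : j < q) :
    incidence (F.erase q) j = incidence F j := by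
  rw [incidence, incidence]
  congr 2
  ext i
  simp only [Finset.mem_filter, Finset.mem_erase]
  constructor
  · exact fun h => ⟨h.1.2, h.2⟩
  · exact fun h => ⟨⟨(h.2.trans hqj).ne, h.1⟩, h.2⟩

theorem incidence_mul_incidence_erase_add {F : Finset ι} {j k : ι} (hj : j ∈ F) (hk : k ∈ F)
    (hjk : j ≠ k) :
    incidence F j * incidence (F.erase j) k + incidence F k * incidence (F.erase k) j = 0 := by
  rcases lt_or_gt_of_ne hjk with h | h
  · rw [incidence_erase_of_lt hj h, incidence_erase_of_gt h]
    ring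
  · rw [incidence_erase_of_lt hk h, incidence_erase_of_gt h]
    ring

theorem boundary_boundary (x : Finset ι →₀ R) : boundary R (boundary R x) = 0 := by
  induction x using Finsupp.induction_linear with
  | zero => simp
  | add x y hx hy => simp [hx, hy]
  | single F r =>
    simp only [boundary_single, map_sum, map_zsmul, Finset.smul_sum, smul_smul]
    rw [Finset.sum_sigma']
    -- Deleting `j` and `k` in the two possible orders gives opposite signs.
    refine Finset.sum_involution (fun p _ => ⟨p.2, p.1⟩) ?_ ?_ ?_ ?_
    · rintro ⟨j, k⟩ h
      simp only [Finset.mem_sigma, Finset.mem_erase] at h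
      rw [Finset.erase_right_comm, ← add_smul,
        incidence_mul_incidence_erase_add h.1 h.2.2 (Ne.symm h.2.1), zero_smul]
    · rintro ⟨j, k⟩ h - heq
      simp only [Finset.mem_sigma, Finset.mem_erase] at h
      simp only [Sigma.mk.injEq, heq_eq_eq] at heq
      exact h.2.1 heq.1
    · rintro ⟨j, k⟩ h
      simp only [Finset.mem_sigma, Finset.mem_erase] at h ⊢
      exact ⟨h.2.2, Ne.symm h.2.1, h.1⟩
    · rintro ⟨j, k⟩ h
      rfl

/-- Adjoining a vertex that lies below all others is a contracting homotopy. -/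
theorem boundary_cone_add_cone_boundary_single {q : ι} {F : Finset ι} (hq : ∀ i ∈ F, q ≤ i)
    (r : R) :
    boundary R (cone R q (Finsupp.single F r)) + cone R q (boundary R (Finsupp.single F r)) =
      Finsupp.single F r := by
  by_cases h : q ∈ F
  -- The cone kills every face that still contains `q`; only the face omitting `q` survives.
  · rw [cone_single, if_pos h, map_zero, zero_add, boundary_single, map_sum,
      Finset.sum_eq_single_of_mem q h, incidence_eq_one hq, one_smul, cone_single,
      if_neg (Finset.notMem_erase q F), Finset.insert_erase h]
    intro j _ hjq
    rw [map_zsmul, cone_single, if_pos (Finset.mem_erase.2 ⟨hjq.symm, h⟩), smul_zero]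
  · have hq' : ∀ i ∈ insert q F, q ≤ i := by simpa using hq
    -- Omitting `q` again returns `F`. The other faces cancel, since a new first vertex flips their
    -- signs.
    rw [cone_single, if_neg h, boundary_single, boundary_single, Finset.sum_insert h,
      incidence_eq_one hq', one_smul, Finset.erase_insert h, map_sum, add_assoc,
      ← Finset.sum_add_distrib, Finset.sum_eq_zero, add_zero]
    intro j hj
    have hqj : q ≠ j := fun e => h (e ▸ hj)
    rw [map_zsmul, cone_single, if_neg (fun h' => h (Finset.mem_of_mem_erase h')),
      Finset.erase_insert_of_ne hqj, incidence_insert_of_lt h (lt_of_le_of_ne (hq j hj) hqj),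
      ← add_smul, neg_add_cancel, zero_smul]

end Simplicial

/-! ### Exactness of the Lyubeznik complex -/

noncomputable section Exactness

open MvPolynomial

variable (K : Type*) [Field K] {n : ℕ} {ι : Type} [LinearOrder ι] (m : ι → (Fin n →₀ ℕ))

/-- The embedding of `L^t` in the simplicial complex that multiplies the symbol `F` by the monomial
`lcm(F)`. -/
def homogenize (t : ℕ) : L K m t →ₗ[MvPolynomial (Fin n) K]
    (Finset ι →₀ MvPolynomial (Fin n) K) :=
  Finsupp.linearCombination _ fun F : Symb m t =>
    Finsupp.single F.1 (monomial (multideg m F.1) (1 : K))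

open Classical in
/-- In multidegree `a`, adjoin the least `q` with `m q ∣ a`. -/
def coneDeg (a : Fin n →₀ ℕ) : (Finset ι →₀ MvPolynomial (Fin n) K) →ₗ[MvPolynomial (Fin n) K]
    (Finset ι →₀ MvPolynomial (Fin n) K) :=
  if h : ∃ q, IsLeast {q | m q ≤ a} q then cone _ h.choose else 0

/-- The `K`-linear operator that is `coneDeg` in every multidegree. -/
def homotopy : (Finset ι →₀ MvPolynomial (Fin n) K) →ₗ[K]
    (Finset ι →₀ MvPolynomial (Fin n) K) :=
  Finsupp.lsum K fun F => (basisMonomials (Fin n) K).constr K fun a =>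
    coneDeg K m a (Finsupp.single F (monomial a 1))

variable {K m}

theorem homogenize_single {t : ℕ} (F : Symb m t) (c : Fin n →₀ ℕ) (k : K) :
    homogenize K m t (Finsupp.single F (monomial c k)) =
      Finsupp.single F.1 (monomial (c + multideg m F.1) k) := by
  simp [homogenize, monomial_mul]

theorem homogenize_injective (t : ℕ) : Function.Injective (homogenize K m t) := by
  have happ (x : L K m t) (F : Symb m t) :
      homogenize K m t x F.1 = x F * monomial (multideg m F.1) 1 := by
    induction x using Finsupp.induction_linear with
    | zero => simp
    | add x y hx hy => simp [hx, hy, add_mul]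
    | single F' p =>
      by_cases h : F' = F
      · subst h
        simp [homogenize]
      · simp [homogenize, h, Subtype.ext_iff.not.1 h]
  rw [injective_iff_map_eq_zero]
  intro x hx
  ext1 F
  have h := happ x F
  rw [hx, Finsupp.zero_apply, eq_comm, mul_eq_zero] at h
  simpa using h

theorem monomial_neg_one_pow (c : Fin n →₀ ℕ) (r : ℕ) :
    monomial c ((-1 : K) ^ r) = ((-1 : ℤ) ^ r) • monomial c (1 : K) := by
  rcases neg_one_pow_eq_or ℤ r with h | h
  · have h' : (-1 : K) ^ r = 1 := by exact_mod_cast congrArg (Int.cast : ℤ → K) h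
    simp [h, h']
  · have h' : (-1 : K) ^ r = -1 := by exact_mod_cast congrArg (Int.cast : ℤ → K) h
    simp [h, h']

theorem homogenize_differential (t : ℕ) (x : L K m (t + 1)) :
    homogenize K m t (differential K m t x) = boundary _ (homogenize K m (t + 1) x) := by
  suffices h : homogenize K m t ∘ₗ differential K m t = boundary _ ∘ₗ homogenize K m (t + 1) from
    LinearMap.congr_fun h x
  refine Finsupp.lhom_ext' fun F => LinearMap.ext_ring ?_
  have h1 : homogenize K m (t + 1) (Finsupp.single F 1) =
      Finsupp.single F.1 (monomial (multideg m F.1) 1) := by simp [homogenize]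
  simp only [LinearMap.comp_apply, Finsupp.lsingle_apply, h1, boundary_single]
  simp only [differential, Finsupp.linearCombination_single, one_smul, map_sum,
    homogenize_single]
  rw [← Finset.sum_attach F.1]
  refine Finset.sum_congr rfl fun j _ => ?_
  have h2 : multideg m (F.1.erase j.1) ≤ multideg m F.1 := multideg_mono (Finset.erase_subset _ _)
  rw [Symb.face, tsub_add_cancel_of_le h2, monomial_neg_one_pow, incidence, Finsupp.smul_single]

theorem homotopy_single (F : Finset ι) (a : Fin n →₀ ℕ) (k : K) :
    homotopy K m (Finsupp.single F (monomial a k)) =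
      coneDeg K m a (Finsupp.single F (monomial a k)) := by
  have h : monomial a k = k • basisMonomials (Fin n) K a := by simp [smul_monomial]
  have h' : monomial a k = (C k : MvPolynomial (Fin n) K) • monomial a (1 : K) := by
    simp [C_mul_monomial]
  rw [homotopy, Finsupp.lsum_single, h, map_smul, Module.Basis.constr_basis, ← h, h',
    ← Finsupp.smul_single, map_smul, ← algebraMap_eq, algebraMap_smul]

/-- The boundary preserves multidegree, so one and the same cone vertex serves both terms of the
homotopy identity. -/
theorem homotopy_boundary_single (F : Finset ι) (a : Fin n →₀ ℕ) (k : K) :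
    homotopy K m (boundary _ (Finsupp.single F (monomial a k))) =
      coneDeg K m a (boundary _ (Finsupp.single F (monomial a k))) := by
  simp only [boundary_single, map_sum, map_zsmul, homotopy_single]

theorem L.induction {t : ℕ} {P : L K m t → Prop} (x : L K m t) (zero : P 0)
    (add : ∀ x y, P x → P y → P (x + y))
    (single : ∀ F c k, P (Finsupp.single F (monomial c k))) : P x := by
  induction x using Finsupp.induction_linear with
  | zero => exact zero
  | add x y hx hy => exact add x y hx hy
  | single F p =>
    induction p using MvPolynomial.induction_on' with
    | monomial c k => exact single F c k
    | add p q hp hq => simpa using add _ _ hp hq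

theorem exists_isLeast_of_le [Finite ι] {a : Fin n →₀ ℕ} {i : ι} (hi : m i ≤ a) :
    ∃ q, IsLeast {q | m q ≤ a} q := by
  obtain ⟨q, hq, hmin⟩ := Set.exists_min_image {q | m q ≤ a} id (Set.toFinite _) ⟨i, hi⟩
  exact ⟨q, hq, hmin⟩

theorem boundary_homotopy_add_homotopy_boundary [Finite ι] {t : ℕ} (x : L K m (t + 1)) :
    boundary _ (homotopy K m (homogenize K m (t + 1) x)) +
      homotopy K m (boundary _ (homogenize K m (t + 1) x)) = homogenize K m (t + 1) x := by
  induction x using L.induction with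
  | zero => simp
  | add x y hx hy =>
    conv_rhs => rw [map_add, ← hx, ← hy]
    simp only [map_add]
    abel
  | single F c k =>
    -- A symbol of positive dimension has a vertex, whose generator divides the multidegree; so
    -- `coneDeg` is a true cone here and not the default `0`.
    obtain ⟨i, hi⟩ : F.1.Nonempty := by
      rw [← Finset.card_pos, F.2.2]
      exact t.succ_pos
    have hle {i : ι} (hi : i ∈ F.1) : m i ≤ c + multideg m F.1 :=
      (multideg_le.1 le_rfl i hi).trans le_add_self
    have hex := exists_isLeast_of_le (hle hi)
    rw [homogenize_single, homotopy_boundary_single, homotopy_single, coneDeg, dif_pos hex]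
    exact boundary_cone_add_cone_boundary_single
      (fun j hj => hex.choose_spec.2 (hle hj)) _

/-- The contraction restricts to the Lyubeznik complex: nothing below `q` divides the multidegree,
so the tail starting at `q` is harmless, and the later tails are those of `F`. -/
theorem homotopy_homogenize_mem_range {t : ℕ} (x : L K m t) :
    homotopy K m (homogenize K m t x) ∈ LinearMap.range (homogenize K m (t + 1)) := by
  induction x using L.induction with
  | zero => simp
  | add x y hx hy => simpa using add_mem hx hy
  | single F c k =>
    rw [homogenize_single, homotopy_single, coneDeg]
    split_ifs with hex
    · obtain ⟨hq, hmin⟩ := hex.choose_spec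
      set q := hex.choose
      rw [cone_single]
      split_ifs with hqF
      · exact zero_mem _
      · have hle {i : ι} (hi : i ∈ F.1) : m i ≤ c + multideg m F.1 :=
          (multideg_le.1 le_rfl i hi).trans le_add_self
        have hins : multideg m (insert q F.1) ≤ c + multideg m F.1 :=
          multideg_le.2 fun i hi => by
            rcases Finset.mem_insert.1 hi with rfl | hi
            · exact hq
            · exact hle hi
        have hadm : IsLAdmissible m (insert q F.1) := by
          intro i hi ⟨j, hj, hij⟩ p hp hpm
          rcases Finset.mem_insert.1 hi with rfl | hi
          · exact hp.not_ge
              (hmin ((hpm.trans (multideg_mono (Finset.filter_subset _ _))).trans hins))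
          · have hqi : q < i := lt_of_le_of_ne (hmin (hle hi)) fun e => hqF (e ▸ hi)
            have hjF : j ∈ F.1 := (Finset.mem_insert.1 hj).resolve_left fun e =>
              (hqi.trans hij).ne' e
            rw [Finset.filter_insert, if_neg hqi.not_ge] at hpm
            exact F.2.1 i hi ⟨j, hjF, hij⟩ p hp hpm
        refine ⟨Finsupp.single ⟨insert q F.1, hadm, by
          rw [Finset.card_insert_of_notMem hqF, F.2.2]⟩
          (monomial (c + multideg m F.1 - multideg m (insert q F.1)) k), ?_⟩
        rw [homogenize_single, tsub_add_cancel_of_le hins]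
    · exact zero_mem _

variable (K m) in
theorem exact_differential [Finite ι] (t : ℕ) :
    Function.Exact (differential K m (t + 1)) (differential K m t) := by
  intro x
  constructor
  · intro hx
    obtain ⟨y, hy⟩ := homotopy_homogenize_mem_range x
    refine ⟨y, homogenize_injective _ ?_⟩
    -- For a cycle the homotopy identity exhibits it as a boundary.
    have h := boundary_homotopy_add_homotopy_boundary x
    rw [← homogenize_differential, hx, map_zero, map_zero, add_zero] at h
    rw [homogenize_differential, hy, h]
  · rintro ⟨y, rfl⟩
    apply homogenize_injective
    rw [homogenize_differential, homogenize_differential, boundary_boundary, map_zero]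

end Exactness

/-! ### The augmentation and exactness at `L^0`. -/

section Augmentation

open MvPolynomial

variable {K : Type*} [Field K] {n : ℕ} {ι : Type} [LinearOrder ι] {m : ι → (Fin n →₀ ℕ)}

theorem differential_single_one {t : ℕ} (F : Symb m (t + 1)) :
    differential K m t (Finsupp.single F 1) =
      ∑ j ∈ F.1.attach, Finsupp.single (F.face j)
        (monomial (multideg m F.1 - multideg m (F.1.erase j.1))
          ((-1 : K) ^ (F.1.filter (fun i => i < j.1)).card)) := by
  simp [differential]

theorem range_differential_le_iff {t : ℕ}
    {N : Submodule (MvPolynomial (Fin n) K) (L K m t)} :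
    LinearMap.range (differential K m t) ≤ N ↔
      ∀ F, differential K m t (Finsupp.single F 1) ∈ N := by
  constructor
  · exact fun h F => h ⟨_, rfl⟩
  · rintro h _ ⟨x, rfl⟩
    induction x using Finsupp.induction_linear with
    | zero => simp
    | add x y hx hy => simpa using add_mem hx hy
    | single F p =>
      rw [← mul_one p, ← smul_eq_mul, ← Finsupp.smul_single, map_smul]
      exact N.smul_mem p (h F)

theorem isLAdmissible_of_card_le_one {F : Finset ι} (h : F.card ≤ 1) : IsLAdmissible m F := by
  intro i hi ⟨j, hj, hij⟩
  exact absurd (Finset.card_le_one.1 h i hi j hj) hij.ne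

variable (m) in
/-- The empty symbol. -/
def Symb.empty : Symb m 0 := ⟨∅, isLAdmissible_of_card_le_one (by simp), rfl⟩

theorem Symb.eq_empty (F : Symb m 0) : F = Symb.empty m :=
  Subtype.ext (Finset.card_eq_zero.1 F.2.2)

theorem L.eq_single_empty (x : L K m 0) : x = Finsupp.single (Symb.empty m) (x (Symb.empty m)) := by
  ext1 F
  rw [F.eq_empty, Finsupp.single_eq_same]

theorem differential_singleton (i : ι) :
    differential K m 0 (Finsupp.single
      ⟨{i}, isLAdmissible_of_card_le_one (by simp), Finset.card_singleton i⟩ 1) =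
      Finsupp.single (Symb.empty m) (monomial (m i) (1 : K)) := by
  rw [differential_single_one]
  rw [← Finset.univ_eq_attach, Fintype.sum_unique]
  simp [multideg, Symb.eq_empty, Finset.filter_singleton, bot_eq_zero]

theorem augmentation_apply (I : Ideal (MvPolynomial (Fin n) K)) (x : L K m 0) :
    augmentation K m I x = Ideal.Quotient.mk I (x (Symb.empty m)) := by
  conv_lhs => rw [L.eq_single_empty x]
  rw [augmentation, Finsupp.linearCombination_single, ← map_one (Ideal.Quotient.mk I)]
  exact congrArg (Ideal.Quotient.mk I) (mul_one _)

theorem augmentation_surjective (I : Ideal (MvPolynomial (Fin n) K)) :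
    Function.Surjective (augmentation K m I) := by
  intro y
  obtain ⟨r, rfl⟩ := Ideal.Quotient.mk_surjective y
  exact ⟨Finsupp.single (Symb.empty m) r, by simp [augmentation_apply]⟩

theorem exact_augmentation {I : Ideal (MvPolynomial (Fin n) K)}
    (hI : I = Ideal.span (Set.range fun i => monomial (m i) (1 : K))) :
    Function.Exact (differential K m 0) (augmentation K m I) := by
  intro x
  rw [augmentation_apply, Ideal.Quotient.eq_zero_iff_mem]
  constructor
  · intro hx
    have hle : I ≤ (LinearMap.range (differential K m 0)).comap
        (Finsupp.lsingle (Symb.empty m)) := by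
      rw [hI]
      refine Ideal.span_le.2 ?_
      rintro _ ⟨i, rfl⟩
      exact ⟨_, differential_singleton i⟩
    rw [L.eq_single_empty x]
    exact hle hx
  · rintro ⟨y, rfl⟩
    have hle : LinearMap.range (differential K m 0) ≤
        Submodule.comap (Finsupp.lapply (Symb.empty m)) I := by
      refine range_differential_le_iff.2 fun F => ?_
      obtain ⟨i, hi⟩ := Finset.card_eq_one.1 F.2.2
      obtain rfl : F = ⟨{i}, isLAdmissible_of_card_le_one (by simp), Finset.card_singleton i⟩ :=
        Subtype.ext hi
      rw [differential_singleton, Submodule.mem_comap, Finsupp.lapply_apply,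
        Finsupp.single_eq_same, hI]
      exact Ideal.subset_span ⟨i, rfl⟩
    exact hle ⟨y, rfl⟩

end Augmentation

/-! ### Minimality of the differential in terms of covers. -/

section Minimality

open MvPolynomial

variable {K : Type*} [Field K] {n : ℕ} {ι : Type} [LinearOrder ι] {m : ι → (Fin n →₀ ℕ)}

theorem monomial_mem_span_range_X_iff {c : Fin n →₀ ℕ} {k : K} (hk : k ≠ 0) :
    monomial c k ∈ Ideal.span (Set.range (X : Fin n → MvPolynomial (Fin n) K)) ↔ c ≠ 0 := by
  classical
  rw [← Set.image_univ, mem_ideal_span_X_image]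
  simp [support_monomial, hk, DFunLike.ne_iff]

/-- Different omitted vertices give different faces, so no terms combine. -/
theorem differential_single_one_apply_face {t : ℕ} (F : Symb m (t + 1)) (j : {j // j ∈ F.1}) :
    differential K m t (Finsupp.single F 1) (F.face j) =
      monomial (multideg m F.1 - multideg m (F.1.erase j.1))
          ((-1 : K) ^ (F.1.filter (fun i => i < j.1)).card) := by
  rw [differential_single_one, Finsupp.finsetSum_apply,
    Finset.sum_eq_single_of_mem j (Finset.mem_attach _ _), Finsupp.single_eq_same]
  intro i _ hij
  refine Finsupp.single_eq_of_ne fun h => hij ?_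
  have h' : F.1.erase j.1 = F.1.erase i.1 := congrArg Subtype.val h
  by_contra hne
  have : i.1 ∈ F.1.erase j.1 := Finset.mem_erase.2 ⟨fun e => hne (Subtype.ext e), i.2⟩
  rw [h'] at this
  exact Finset.notMem_erase _ _ this

theorem isCover_iff_multideg_tsub_eq_zero {F : Finset ι} {j : ι} (hj : j ∈ F) :
    IsCover m F j ↔ multideg m F - multideg m (F.erase j) = 0 := by
  rw [tsub_eq_zero_iff_le, IsCover, and_iff_right hj]
  constructor
  · intro h
    refine multideg_le.2 fun i hi => ?_
    by_cases hij : i = j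
    · exact hij ▸ h
    · exact multideg_le.1 le_rfl i (Finset.mem_erase.2 ⟨hij, hi⟩)
  · exact fun h => (multideg_le.1 le_rfl j hj).trans h

theorem minimal_differential_iff :
    (∀ t, LinearMap.range (differential K m t) ≤
      Ideal.span (Set.range (X : Fin n → MvPolynomial (Fin n) K)) • (⊤ : Submodule _ (L K m t))) ↔
    ∀ u C, IsCover m C u → ¬ IsLAdmissible m C := by
  have hsign (r : ℕ) : ((-1 : K) ^ r) ≠ 0 := pow_ne_zero _ (neg_ne_zero.2 one_ne_zero)
  constructor
  · intro h u C hC hadm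
    have hcard : C.card = (C.card - 1) + 1 :=
      (Nat.sub_add_cancel (Finset.card_pos.2 ⟨u, hC.1⟩)).symm
    let F : Symb m ((C.card - 1) + 1) := ⟨C, hadm, hcard⟩
    have h1 := range_differential_le_iff.1 (h (C.card - 1)) F
    have h2 := Submodule.mem_map_of_mem (f := Finsupp.lapply (F.face ⟨u, hC.1⟩)) h1
    rw [Submodule.map_smul''] at h2
    have h3 := Submodule.smul_mono le_rfl le_top h2
    rw [smul_eq_mul, ← Ideal.one_eq_top, mul_one, Finsupp.lapply_apply,
      differential_single_one_apply_face, monomial_mem_span_range_X_iff (hsign _)] at h3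
    exact h3 ((isCover_iff_multideg_tsub_eq_zero hC.1).1 hC)
  · intro h t
    refine range_differential_le_iff.2 fun F => ?_
    rw [differential_single_one]
    refine Submodule.sum_mem _ fun j _ => ?_
    rw [← mul_one (monomial _ _), ← smul_eq_mul, ← Finsupp.smul_single]
    refine Submodule.smul_mem_smul ((monomial_mem_span_range_X_iff (hsign _)).2 fun h0 => ?_)
      Submodule.mem_top
    exact h j.1 F.1 ((isCover_iff_multideg_tsub_eq_zero j.2).2 h0) F.2.1

end Minimality

section MonomialIdeals

open MvPolynomial

variable {K : Type*} [Field K] {n : ℕ} {I : Ideal (MvPolynomial (Fin n) K)}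

theorem eq_of_gen_le_gen (i j : G I) (h : gen I i ≤ gen I j) : i = j :=
  Subtype.ext (le_antisymm h (j.2.2 i.2.1 h))

instance : Finite (G I) := by
  have hanti : IsAntichain (· ≤ ·) {a | Minimal (fun b => monomial b (1 : K) ∈ I) a} :=
    fun a ha b hb hab hle => hab (le_antisymm hle (hb.2 ha.1 hle))
  exact (hanti.finite_of_partiallyWellOrderedOn (Set.isPWO_of_wellQuasiOrderedLE _)).to_subtype

theorem eq_span_range_gen (hI : IsMonomialIdeal I) :
    I = Ideal.span (Set.range fun i => monomial (gen I i) (1 : K)) := by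
  refine le_antisymm ?_ ?_
  · obtain ⟨S, hS⟩ := hI
    conv_lhs => rw [hS]
    refine Ideal.span_le.2 ?_
    rintro _ ⟨a, ha, rfl⟩
    have haI : monomial a (1 : K) ∈ I := hS ▸ Ideal.subset_span ⟨a, ha, rfl⟩
    obtain ⟨b, hba, hb⟩ := exists_minimal_le_of_wellFoundedLT
      (fun b => monomial b (1 : K) ∈ I) a haI
    have h1 : monomial a (1 : K) = monomial (a - b) 1 * monomial b 1 := by
      rw [monomial_mul, tsub_add_cancel_of_le hba, one_mul]
    simp only [h1]
    exact Ideal.mul_mem_left _ _ (Ideal.subset_span ⟨(⟨b, hb⟩ : G I), rfl⟩)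
  · refine Ideal.span_le.2 ?_
    rintro _ ⟨i, rfl⟩
    exact i.2.1

theorem lyubeznikIsMinimal_iff (hI : IsMonomialIdeal I) [LinearOrder (G I)] :
    LyubeznikIsMinimal I ↔ ∀ u C, IsCover (gen I) C u → ¬ IsPreserved (gen I) C := by
  simp only [← isLAdmissible_iff_isPreserved eq_of_gen_le_gen, ← minimal_differential_iff (K := K)]
  exact ⟨fun h => h.minimal, fun h => ⟨fun _ => inferInstance, exact_differential K (gen I),
    exact_augmentation (eq_span_range_gen hI), augmentation_surjective I, h⟩⟩

end MonomialIdeals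

end LyubeznikRes

theorem mainTheorem2 {K : Type*} [Field K] {n : ℕ} (I : Ideal (MvPolynomial (Fin n) K))
    (hI : LyubeznikRes.IsMonomialIdeal I) :
    (∀ _ : LinearOrder (LyubeznikRes.G I), List.TFAE [
      LyubeznikRes.LyubeznikIsMinimal I,
      ∀ u C, LyubeznikRes.IsCover (LyubeznikRes.gen I) C u →
        ¬ LyubeznikRes.IsPreserved (LyubeznikRes.gen I) C,
      ∀ u C, LyubeznikRes.IsCover (LyubeznikRes.gen I) C u →
        ∃ D v, D ⊆ C ∧ v ∉ D ∧ LyubeznikRes.IsCover (LyubeznikRes.gen I) (insert v D) v ∧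
          LyubeznikRes.MinCondition (LyubeznikRes.gen I) D,
      ∀ u C, LyubeznikRes.IsEMinimalCover (LyubeznikRes.gen I) C u →
        ¬ LyubeznikRes.IsPreserved (LyubeznikRes.gen I) C,
      ∀ u C, LyubeznikRes.IsEMinimalCover (LyubeznikRes.gen I) C u →
        ∃ D v, D ⊆ C ∧ v ∉ D ∧ LyubeznikRes.IsEMinimalCover (LyubeznikRes.gen I) (insert v D) v ∧
          LyubeznikRes.MinCondition (LyubeznikRes.gen I) D]) ∧
    List.TFAE [
      LyubeznikRes.IsLyubeznikIdeal I,
      ∃ _ : LinearOrder (LyubeznikRes.G I),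
        ∀ u C, LyubeznikRes.IsCover (LyubeznikRes.gen I) C u →
          ¬ LyubeznikRes.IsPreserved (LyubeznikRes.gen I) C,
      ∃ _ : LinearOrder (LyubeznikRes.G I),
        ∀ u C, LyubeznikRes.IsCover (LyubeznikRes.gen I) C u →
          ∃ D v, D ⊆ C ∧ v ∉ D ∧ LyubeznikRes.IsCover (LyubeznikRes.gen I) (insert v D) v ∧
            LyubeznikRes.MinCondition (LyubeznikRes.gen I) D,
      ∃ _ : LinearOrder (LyubeznikRes.G I),
        ∀ u C, LyubeznikRes.IsEMinimalCover (LyubeznikRes.gen I) C u →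
          ¬ LyubeznikRes.IsPreserved (LyubeznikRes.gen I) C,
      ∃ _ : LinearOrder (LyubeznikRes.G I),
        ∀ u C, LyubeznikRes.IsEMinimalCover (LyubeznikRes.gen I) C u →
          ∃ D v, D ⊆ C ∧ v ∉ D ∧ LyubeznikRes.IsEMinimalCover (LyubeznikRes.gen I) (insert v D) v ∧
            LyubeznikRes.MinCondition (LyubeznikRes.gen I) D] := by
  have key (_ : LinearOrder (LyubeznikRes.G I)) :=
    List.tfae_cons_cons.2 ⟨LyubeznikRes.lyubeznikIsMinimal_iff hI,
      LyubeznikRes.tfae_forall_cover_not_isPreserved LyubeznikRes.eq_of_gen_le_gen⟩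
  refine ⟨key, ?_⟩
  tfae_have 1 ↔ 2 := exists_congr fun o => (key o).out 0 1
  tfae_have 1 ↔ 3 := exists_congr fun o => (key o).out 0 2
  tfae_have 1 ↔ 4 := exists_congr fun o => (key o).out 0 3
  tfae_have 1 ↔ 5 := exists_congr fun o => (key o).out 0 4
  tfae_finish
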